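/- Let $m\ge 1$ and consider the scalar delay differential equation $$x'(t)=\sum_{j=1}^m p_j(t)\,x(t-\tau_j(t))\,e^{-a_j(t)x(t-\sigma_j(t))}-\delta(t)x(t),\qquad t\ge 0. \tag{1}$$ Write $p(t)=\sum_{j=1}^m p_j(t)$, $a^+=\max_j\sup_{t\ge0}a_j(t)$, $\tau=\max_j\max\{\sup_{t\ge0}\tau_j(t),\sup_{t\ge0}\sigma_j(t)\}$ and $$\zeta^+=\max_{1\le j\le m}\limsup_{t\to\infty}\int_{t-\sigma_j(t)}^t\delta(s)\,ds .$$ Assume: (A0) $p_j,a_j,\delta:[0,\infty)\to(0,\infty)$ and $\tau_j,\sigma_j:[0,\infty)\to[0,\infty)$ are continuous, the $\tau_j,\sigma_j$ are bounded, and each $a_j$ is bounded above and bounded below by positive constants; (A1) $\liminf_{t\to\infty}p(t)/\delta(t)>1$ and $\limsup_{t\to\infty}p(t)/\delta(t)<\infty$; (A2) $\limsup_{t\to\infty}\int_{t-\tau}^t p(s)\,ds<\infty$; (A3) $\int_0^\infty\delta(s)\,ds=\infty$; (K1) there is a positive equilibrium $K$ of (1), i.e. $K>0$ and $\delta(t)=\sum_{j=1}^m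 p_j(t)e^{-a_j(t)K}$ for all $t\ge0$; (K2) $a^+K\,(e^{\zeta^+}-1)\le 1$. Then the equilibrium $K$ is globally attractive: every solution $x:[-\tau,\infty)\to\mathbb R$ of (1) whose initial function $\phi=x|_{[-\tau,0]}$ is continuous with $\phi\ge 0$ on $[-\tau,0)$ and $\phi(0)>0$ satisfies $\lim_{t\to\infty}x(t)=K$. -/

import Mathlib

open Filter Topology Set

/-- Coefficients and delays of the scalar delay differential equation
`x'(t) = ∑ j, p j t * x (t - τ j t) * exp (-(a j t) * x (t - σ j t)) - δ t * x t`, `t ≥ 0`.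
Only the values at times `t ≥ 0` matter. -/
structure NicholsonEq (m : ℕ) where
  p : Fin m → ℝ → ℝ
  a : Fin m → ℝ → ℝ
  δ : ℝ → ℝ
  τ : Fin m → ℝ → ℝ
  σ : Fin m → ℝ → ℝ

namespace NicholsonEq

variable {m : ℕ}

/-- `f⁺ = sup_{t ≥ 0} f t` (used only for functions bounded on `[0, ∞)`). -/
noncomputable def supPlus (f : ℝ → ℝ) : ℝ := sSup (f '' Ici 0)

/-- `p(t) = ∑ j, p j t`. -/
noncomputable def pTot (E : NicholsonEq m) (t : ℝ) : ℝ := ∑ j, E.p j t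

/-- `a⁺ = max_j sup_{t ≥ 0} a j t`. -/
noncomputable def aPlus (E : NicholsonEq m) : ℝ := ⨆ j, supPlus (E.a j)

/-- The maximal delay `τ = max_j {sup_{t ≥ 0} τ j t, sup_{t ≥ 0} σ j t}`. -/
noncomputable def maxDelay (E : NicholsonEq m) : ℝ :=
  max (⨆ j, supPlus (E.τ j)) (⨆ j, supPlus (E.σ j))

/-- `ζ⁺ = max_j limsup_{t → ∞} ∫_{t - σ j t}^t δ(s) ds`. Under `A0`, `A1`, `A2` below the
integrals are bounded for large `t`, so this is a limsup of (eventually) bounded functions. -/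
noncomputable def zetaPlus (E : NicholsonEq m) : ℝ :=
  ⨆ j, limsup (fun t : ℝ => ∫ s in (t - E.σ j t)..t, E.δ s) atTop

/-- General conditions on coefficients and delays. -/
structure A0 (E : NicholsonEq m) : Prop where
  p_cont : ∀ j, ContinuousOn (E.p j) (Ici 0)
  p_pos : ∀ j, ∀ t ≥ 0, 0 < E.p j t
  a_cont : ∀ j, ContinuousOn (E.a j) (Ici 0)
  a_bdd : ∀ j, ∃ c C : ℝ, 0 < c ∧ ∀ t ≥ 0, c ≤ E.a j t ∧ E.a j t ≤ C
  δ_cont : ContinuousOn E.δ (Ici 0)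
  δ_pos : ∀ t ≥ 0, 0 < E.δ t
  τ_cont : ∀ j, ContinuousOn (E.τ j) (Ici 0)
  τ_bdd : ∀ j, ∃ C : ℝ, ∀ t ≥ 0, 0 ≤ E.τ j t ∧ E.τ j t ≤ C
  σ_cont : ∀ j, ContinuousOn (E.σ j) (Ici 0)
  σ_bdd : ∀ j, ∃ C : ℝ, ∀ t ≥ 0, 0 ≤ E.σ j t ∧ E.σ j t ≤ C

/-- `liminf p/δ > 1` and `limsup p/δ < ∞` as `t → ∞` (in the extended reals). -/
def A1 (E : NicholsonEq m) : Prop :=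
  1 < liminf (fun t : ℝ => ((E.pTot t / E.δ t : ℝ) : EReal)) atTop ∧
    limsup (fun t : ℝ => ((E.pTot t / E.δ t : ℝ) : EReal)) atTop < ⊤

/-- `limsup_{t → ∞} ∫_{t - τ}^t p(s) ds < ∞` (in the extended reals). -/
def A2 (E : NicholsonEq m) : Prop :=
  limsup (fun t : ℝ => ((∫ s in (t - E.maxDelay)..t, E.pTot s : ℝ) : EReal)) atTop < ⊤

/-- `∫_0^∞ δ(s) ds = ∞`. -/
def A3 (E : NicholsonEq m) : Prop :=
  Tendsto (fun T : ℝ => ∫ s in (0 : ℝ)..T, E.δ s) atTop atTop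

/-- `K` is a positive equilibrium. -/
def IsPositiveEquilibrium (E : NicholsonEq m) (K : ℝ) : Prop :=
  0 < K ∧ ∀ t ≥ 0, E.δ t = ∑ j, E.p j t * Real.exp (-(E.a j t) * K)

/-- The set `C₀⁺` of admissible initial conditions on `[-τ, 0]`. -/
def InitialCone (E : NicholsonEq m) : Set (ℝ → ℝ) :=
  {φ | ContinuousOn φ (Icc (-E.maxDelay) 0) ∧
    (∀ θ ∈ Ico (-E.maxDelay) 0, 0 ≤ φ θ) ∧ 0 < φ 0}

/-- `x` is a solution of the equation, continuous on `[-τ, ∞)` and satisfying the equation on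
`[0, ∞)` (with the right derivative at `0`). -/
def IsSolution (E : NicholsonEq m) (x : ℝ → ℝ) : Prop :=
  ContinuousOn x (Ici (-E.maxDelay)) ∧
    ∀ t ≥ 0, HasDerivWithinAt x
      (∑ j, E.p j t * x (t - E.τ j t) * Real.exp (-(E.a j t) * x (t - E.σ j t)) - E.δ t * x t)
      (Ici 0) t

/-- `x` is a solution with initial condition `x_0 = φ`. -/
def IsSolutionWith (E : NicholsonEq m) (φ x : ℝ → ℝ) : Prop :=
  E.IsSolution x ∧ EqOn x φ (Icc (-E.maxDelay) 0)

/-- The nonnegative solution `y` attracts every solution with initial condition in `C₀⁺`. -/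
def IsGlobalAttractor (E : NicholsonEq m) (y : ℝ → ℝ) : Prop :=
  E.IsSolution y ∧ (∀ t ≥ -E.maxDelay, 0 ≤ y t) ∧
    ∀ φ ∈ E.InitialCone, ∀ x : ℝ → ℝ, E.IsSolutionWith φ x →
      Tendsto (fun t => x t - y t) atTop (𝓝 0)

end NicholsonEq

/-! Since the weights `p_j e^{-a_j K}` sum to `δ`, the equation drives `x` at rate `δ` towards a
weighted mean of the values `x(t-τ_j) e^{a_j (K - x(t-σ_j))}`. Suppose first that `x` is bounded
above and away from zero, and let `l ≤ K ≤ M` be asymptotic bounds. If every `x(t-σ_j)` exceeds `K`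
by a margin, the mean is well below `M`, and `∫ δ = ∞` pushes `x` down
(`eventually_le_of_deriv_le`). So `x` can stay near `M` only if some `x(t-σ_j)` is about `K` or
less. From that time the target is at most `M e^{a⁺(K-l)}` and `∫ δ` is at most about `z = ζ⁺`,
whence `M ≤ K e^{-z} + M e^{a⁺(K-l)} (1 - e^{-z})`. Symmetrically, `l ≥ K e^{-z} + l e^{-a⁺(M-K)} (1
- e^{-z})`. When `a⁺K(e^z - 1) ≤ 1` these force `M = l = K`, by the scalar inequality
`exp_div_lt_one_add_div`. Boundedness rests on a Harnack inequality (`exists_harnack`): values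
within one delay are comparable. Large values then make the exponential factor negligible, while
small values make production exceed loss. -/

/-! ### Scalar differential inequalities -/

/-- A function continuous on `[0, ∞)` has a primitive there, differentiable at `0` as well. -/
theorem exists_primitive_Ici {f : ℝ → ℝ} (hf : ContinuousOn f (Ici 0)) :
    ∃ F : ℝ → ℝ, (∀ t ≥ 0, HasDerivAt F (f t) t) ∧
      ∀ s t, 0 ≤ s → 0 ≤ t → ∫ r in s..t, f r = F t - F s := by
  -- Freezing `f` at `f 0` on the negative axis makes it continuous on the line, hence the two-sided
  -- derivative at `0`.
  have hg : Continuous (fun t => f (max t 0)) :=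
    hf.comp_continuous (continuous_id.max continuous_const) fun t => mem_Ici.2 (le_max_right _ _)
  have hd : ∀ t ≥ 0, HasDerivAt (fun t => ∫ r in (0 : ℝ)..t, f (max r 0)) (f t) t := by
    intro t ht
    have := intervalIntegral.integral_hasDerivAt_right (hg.intervalIntegrable 0 t)
      (hg.stronglyMeasurableAtFilter _ _) hg.continuousAt
    simpa [max_eq_left ht] using this
  refine ⟨_, hd, fun s t hs ht => ?_⟩
  have hsub : uIcc s t ⊆ Ici 0 := fun r hr => le_trans (le_min hs ht) hr.1
  exact intervalIntegral.integral_eq_sub_of_hasDerivAt (fun r hr => hd r (hsub hr))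
    (hf.mono hsub).intervalIntegrable

/-- Integrating factor: `(u - B) e^D` is nonincreasing. The rate `d` may have either sign, and
taking `u = -x` gives lower bounds, so all comparisons below use this form. -/
theorem sub_le_mul_exp_of_deriv_le {u u' D d : ℝ → ℝ} {s t B : ℝ} (hst : s ≤ t)
    (hu : ContinuousOn u (Icc s t)) (hD : ContinuousOn D (Icc s t))
    (hu' : ∀ r ∈ Ioo s t, HasDerivAt u (u' r) r) (hD' : ∀ r ∈ Ioo s t, HasDerivAt D (d r) r)
    (h : ∀ r ∈ Ioo s t, u' r ≤ d r * (B - u r)) :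
    u t - B ≤ (u s - B) * Real.exp (-(D t - D s)) := by
  have hanti : AntitoneOn (fun r => (u r - B) * Real.exp (D r)) (Icc s t) := by
    refine antitoneOn_of_hasDerivWithinAt_nonpos
      (f' := fun r => u' r * Real.exp (D r) + (u r - B) * (Real.exp (D r) * d r))
      (convex_Icc s t) ((hu.sub continuousOn_const).mul hD.rexp) ?_ ?_
    · intro r hr
      rw [interior_Icc] at hr
      exact (((hu' r hr).sub_const B).mul (hD' r hr).exp).hasDerivWithinAt
    · intro r hr
      rw [interior_Icc] at hr
      have : u' r * Real.exp (D r) + (u r - B) * (Real.exp (D r) * d r)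
          = (u' r - d r * (B - u r)) * Real.exp (D r) := by ring
      rw [this]
      exact mul_nonpos_of_nonpos_of_nonneg (sub_nonpos.2 (h r hr)) (Real.exp_pos _).le
  have h1 := hanti (left_mem_Icc.2 hst) (right_mem_Icc.2 hst) hst
  have h2 : Real.exp (-(D t - D s)) = Real.exp (D s) * Real.exp (-D t) := by
    rw [← Real.exp_add]; ring_nf
  have h3 : Real.exp (D t) * Real.exp (-D t) = 1 := by rw [← Real.exp_add]; simp
  have h4 := mul_le_mul_of_nonneg_right h1 (Real.exp_pos (-D t)).le
  simp only at h4
  rw [h2]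
  calc u t - B = (u t - B) * Real.exp (D t) * Real.exp (-D t) := by rw [mul_assoc, h3, mul_one]
    _ ≤ _ := h4
    _ = _ := by ring

/-- A function that decreases at a rate at least `κ d` above the level `A` ends up below `A`,
as soon as `d` is not integrable at infinity. -/
theorem eventually_le_of_deriv_le {u u' D d : ℝ → ℝ} {T A κ : ℝ} (hκ : 0 < κ)
    (hu : ∀ t ≥ T, HasDerivAt u (u' t) t) (hD : ∀ t ≥ T, HasDerivAt D (d t) t)
    (hd : ∀ t ≥ T, 0 ≤ d t) (hlim : Tendsto D atTop atTop)
    (h : ∀ t ≥ T, A < u t → u' t ≤ -(κ * d t)) : ∀ᶠ t in atTop, u t ≤ A := by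
  have hcont : ∀ s, T ≤ s → ∀ t, ContinuousOn (fun r => u r + κ * D r) (Icc s t) :=
    fun s hs t r hr => ((hu r (hs.trans hr.1)).continuousAt.add
      ((hD r (hs.trans hr.1)).continuousAt.const_mul κ)).continuousWithinAt
  have hkey : ∀ s t, T ≤ s → s ≤ t → (∀ r ∈ Ioo s t, A < u r) →
      u t + κ * D t ≤ u s + κ * D s := by
    intro s t hs hst hA
    refine antitoneOn_of_hasDerivWithinAt_nonpos (f := fun r => u r + κ * D r)
      (f' := fun r => u' r + κ * d r) (convex_Icc s t) (hcont s hs t) ?_ ?_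
      (left_mem_Icc.2 hst) (right_mem_Icc.2 hst) hst
    · intro r hr
      rw [interior_Icc] at hr
      have hr' := hs.trans hr.1.le
      exact ((hu r hr').add ((hD r hr').const_mul κ)).hasDerivWithinAt
    · intro r hr
      rw [interior_Icc] at hr
      have := h r (hs.trans hr.1.le) (hA r hr)
      linarith
  have hmono : ∀ s t, T ≤ s → s ≤ t → D s ≤ D t := by
    intro s t hs hst
    refine monotoneOn_of_hasDerivWithinAt_nonneg (f := D) (f' := d) (convex_Icc s t)
      (fun r hr => (hD r (hs.trans hr.1)).continuousAt.continuousWithinAt) ?_ ?_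
      (left_mem_Icc.2 hst) (right_mem_Icc.2 hst) hst
    · intro r hr
      rw [interior_Icc] at hr
      exact (hD r (hs.trans hr.1.le)).hasDerivWithinAt
    · intro r hr
      rw [interior_Icc] at hr
      exact hd r (hs.trans hr.1.le)
  obtain ⟨s, hs, hsA⟩ : ∃ s ≥ T, u s ≤ A := by
    by_contra! hcon
    obtain ⟨t, ht1, ht2⟩ := ((hlim.eventually_gt_atTop ((u T + κ * D T - A) / κ)).and
      (eventually_ge_atTop T)).exists
    have h1 := hkey T t le_rfl ht2 fun r hr => hcon r hr.1.le
    have h2 := hcon t ht2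
    rw [div_lt_iff₀ hκ] at ht1
    linarith
  filter_upwards [eventually_ge_atTop s] with t ht
  by_contra! hAt
  have hucont : ContinuousOn u (Icc s t) :=
    fun r hr => (hu r (hs.le.trans hr.1)).continuousAt.continuousWithinAt
  have hclosed : IsClosed (Icc s t ∩ u ⁻¹' Iic A) :=
    hucont.preimage_isClosed_of_isClosed isClosed_Icc isClosed_Iic
  have hcomp : IsCompact (Icc s t ∩ u ⁻¹' Iic A) :=
    isCompact_Icc.of_isClosed_subset hclosed inter_subset_left
  -- `q` is the last time up to `t` with `u ≤ A`; on `(q, t)` the sum `u + κ D` decreases, so `u`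
  -- cannot have risen above `A`.
  obtain ⟨q, ⟨hq, hqA⟩, hqmax⟩ :=
    hcomp.exists_isGreatest ⟨s, ⟨left_mem_Icc.2 ht, hsA⟩⟩
  have h1 := hkey q t (hs.le.trans hq.1) hq.2 fun r hr => by
    by_contra! hr'
    exact absurd (hqmax ⟨⟨hq.1.trans hr.1.le, hr.2.le⟩, hr'⟩) (not_le.2 hr.1)
  have h2 := hmono q t (hs.le.trans hq.1) hq.2
  have h3 : u q ≤ A := hqA
  nlinarith

/-! ### The algebraic system for the two limits -/

/-- After taking logarithms both sides agree at `y = 0`, and their difference has positive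
derivative. This is used with `c = aK`, `y = a(M - K)` to exclude `M > K`. -/
theorem exp_div_lt_one_add_div {c y : ℝ} (hc : 0 < c) (hy : 0 < y) :
    Real.exp (c * (1 - Real.exp (-y)) / (c + (1 - Real.exp (-y)))) < 1 + c * y / (c + y) := by
  have hden : ∀ r, 0 ≤ r → 0 < c + (1 - Real.exp (-r)) := fun r hr => by
    have : Real.exp (-r) ≤ 1 := Real.exp_le_one_iff.2 (by linarith)
    linarith
  have hpos : ∀ r, 0 ≤ r → 0 < 1 + c * r / (c + r) := fun r hr => by positivity
  have hder : ∀ r, 0 ≤ r → HasDerivAt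
      (fun r => Real.log (1 + c * r / (c + r)) -
        c * (1 - Real.exp (-r)) / (c + (1 - Real.exp (-r))))
      (c ^ 2 / ((c + r) * (c + r + c * r)) - c ^ 2 * Real.exp (-r) / (c + (1 - Real.exp (-r))) ^ 2)
      r := by
    intro r hr
    have hcr : c + r ≠ 0 := by positivity
    have h1 : HasDerivAt (fun r => 1 + c * r / (c + r))
        ((c * 1 * (c + r) - c * r * 1) / (c + r) ^ 2) r :=
      (((hasDerivAt_id r).const_mul c).div ((hasDerivAt_id r).const_add c) hcr).const_add 1
    have h2 : HasDerivAt (fun r => 1 - Real.exp (-r)) (-(Real.exp (-r) * (-1))) r :=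
      ((hasDerivAt_neg r).exp).const_sub 1
    have h3 := (h2.const_mul c).div (h2.const_add c) (hden r hr).ne'
    refine ((h1.log (hpos r hr).ne').sub h3).congr_deriv ?_
    have h4 : c + r + c * r ≠ 0 := by positivity
    have h5 : 1 + c * r / (c + r) = (c + r + c * r) / (c + r) := by field_simp
    rw [h5]
    congr 1
    · field_simp
      ring
    · congr 1
      ring
  have hmono : StrictMonoOn (fun r => Real.log (1 + c * r / (c + r)) -
      c * (1 - Real.exp (-r)) / (c + (1 - Real.exp (-r)))) (Ici 0) := by
    refine strictMonoOn_of_hasDerivWithinAt_pos (convex_Ici 0)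
      (fun r hr => (hder r hr).continuousAt.continuousWithinAt)
      (fun r hr => (hder r (interior_subset hr)).hasDerivWithinAt) fun r hr => ?_
    rw [interior_Ici] at hr
    have hr : 0 < r := hr
    have hd := hden r hr.le
    have he : Real.exp r * Real.exp (-r) = 1 := by rw [← Real.exp_add]; simp
    have h1 : r + 1 < Real.exp r := Real.add_one_lt_exp hr.ne'
    have h2 : 1 + r + r ^ 2 / 2 ≤ Real.exp r := Real.quadratic_le_exp_of_nonneg hr.le
    have h3 : r ^ 2 ≤ Real.exp r + Real.exp (-r) - 2 := by
      have h := Real.self_le_sinh_iff.2 (half_pos hr).le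
      have h' := Real.cosh_two_mul (r / 2)
      rw [mul_div_cancel₀ r two_ne_zero, Real.cosh_sq, Real.cosh_eq] at h'
      nlinarith
    rw [sub_pos, div_lt_div_iff₀ (by positivity) (by positivity)]
    -- Compare coefficients of powers of `c`: `1 + r < e^r`, `2r + r² ≤ 2(e^r - 1)` and `r² ≤ e^r +
    -- e^{-r} - 2`.
    have h4 : (c + r) * (c + r + c * r) <
        c ^ 2 * Real.exp r + 2 * c * (Real.exp r - 1) + (Real.exp r + Real.exp (-r) - 2) := by
      nlinarith [mul_pos (pow_pos hc 2) (sub_pos.2 h1), mul_nonneg hc.le (sub_nonneg.2 h2)]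
    have h5 : (c + (1 - Real.exp (-r))) ^ 2 = Real.exp (-r) *
        (c ^ 2 * Real.exp r + 2 * c * (Real.exp r - 1) + (Real.exp r + Real.exp (-r) - 2)) := by
      linear_combination (-(c ^ 2) - 2 * c - 1) * he
    rw [h5, mul_assoc]
    exact mul_lt_mul_of_pos_left (mul_lt_mul_of_pos_left h4 (Real.exp_pos _)) (by positivity)
  have h0 := hmono (mem_Ici.2 le_rfl) (show y ∈ Ici (0 : ℝ) from hy.le) hy
  simp only [mul_zero, neg_zero, Real.exp_zero, sub_self, zero_div, add_zero, Real.log_one,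
    sub_pos] at h0
  exact (Real.lt_log_iff_exp_lt (hpos y hy.le)).1 h0

/-- The only solution of the two limit inequalities is the trivial one. -/
theorem eq_of_limit_inequalities {a K z M l : ℝ} (ha : 0 < a) (hK : 0 < K) (hz : 0 ≤ z)
    (hKz : a * K * (Real.exp z - 1) ≤ 1) (hKM : K ≤ M) (hl : 0 < l) (hlK : l ≤ K)
    (hM : M ≤ K * Real.exp (-z) + M * Real.exp (a * (K - l)) * (1 - Real.exp (-z)))
    (hl' : K * Real.exp (-z) + l * Real.exp (-(a * (M - K))) * (1 - Real.exp (-z)) ≤ l) :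
    M = K ∧ l = K := by
  have hEz : Real.exp (-z) * Real.exp z = 1 := by rw [← Real.exp_add]; simp
  set e := Real.exp z with he
  have hepos : 0 < e := Real.exp_pos z
  have he1 : 1 ≤ e := Real.one_le_exp hz
  have hc : 0 < a * K := mul_pos ha hK
  set w := 1 - Real.exp (-(a * (M - K))) with hw
  have hw0 : 0 ≤ w := by
    have : Real.exp (-(a * (M - K))) ≤ 1 :=
      Real.exp_le_one_iff.2 (by nlinarith)
    linarith
  have h2 : K ≤ l + l * w * (e - 1) := by
    have := mul_le_mul_of_nonneg_right hl' hepos.le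
    have h : (K * Real.exp (-z) + l * Real.exp (-(a * (M - K))) * (1 - Real.exp (-z))) * e
        = K + l * (1 - w) * (e - 1) := by
      rw [hw]; linear_combination (K - l * Real.exp (-(a * (M - K)))) * hEz
    rw [h] at this
    linarith
  have h1 : M - K ≤ M * (Real.exp (a * (K - l)) - 1) * (e - 1) := by
    have := mul_le_mul_of_nonneg_right hM hepos.le
    have h : (K * Real.exp (-z) + M * Real.exp (a * (K - l)) * (1 - Real.exp (-z))) * e
        = K + M * Real.exp (a * (K - l)) * (e - 1) := by
      linear_combination (K - M * Real.exp (a * (K - l))) * hEz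
    rw [h] at this
    linarith
  -- Multiplying by `aK` lets `aK(e^z - 1) ≤ 1` eliminate `z`; `h1'` does the same for the other
  -- inequality.
  have h2' : a * K * K ≤ l * (a * K + w) := by
    have := mul_le_mul_of_nonneg_left hKz (mul_nonneg hl.le hw0)
    nlinarith
  have hexp : a * (K - l) ≤ a * K * w / (a * K + w) := by
    rw [le_div_iff₀ (by positivity)]
    nlinarith
  have hM0 : 0 < M := hK.trans_le hKM
  have h1' : a * K * (M - K) ≤ M * (Real.exp (a * (K - l)) - 1) := by
    have h3 : 0 ≤ Real.exp (a * (K - l)) - 1 :=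
      sub_nonneg.2 (Real.one_le_exp (mul_nonneg ha.le (by linarith)))
    have := mul_le_mul_of_nonneg_left hKz (mul_nonneg hM0.le h3)
    nlinarith
  have hMK : M = K := by
    by_contra hne
    have hy : 0 < a * (M - K) := mul_pos ha (sub_pos.2 (lt_of_le_of_ne hKM (Ne.symm hne)))
    have h4 := exp_div_lt_one_add_div hc hy
    rw [← hw] at h4
    have h5 := (Real.exp_le_exp.2 hexp).trans_lt h4
    have h6 : a * K * (a * (M - K)) / (a * K + a * (M - K)) = a * K * (M - K) / M := by
      rw [show a * K + a * (M - K) = a * M by ring]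
      field_simp
    rw [h6] at h5
    have h7 : a * K * (M - K) / M ≤ Real.exp (a * (K - l)) - 1 := by
      rw [div_le_iff₀ hM0]; linarith
    linarith
  refine ⟨hMK, le_antisymm hlK ?_⟩
  have : w = 0 := by simp [hw, hMK]
  simpa [this] using h2

/-! ### Bounds for the coefficients and the right-hand side -/

namespace NicholsonEq

variable {m : ℕ} {E : NicholsonEq m}

/-- The right-hand side of the equation. -/
noncomputable def rhs (E : NicholsonEq m) (x : ℝ → ℝ) (t : ℝ) : ℝ :=
  ∑ j, E.p j t * x (t - E.τ j t) * Real.exp (-(E.a j t) * x (t - E.σ j t)) - E.δ t * x t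

theorem le_supPlus {f : ℝ → ℝ} {C t : ℝ} (hf : ∀ t ≥ 0, f t ≤ C) (ht : 0 ≤ t) :
    f t ≤ supPlus f :=
  le_csSup ⟨C, by rintro _ ⟨s, hs, rfl⟩; exact hf s hs⟩ ⟨t, ht, rfl⟩

theorem A0.a_le_aPlus (h : E.A0) (j : Fin m) {t : ℝ} (ht : 0 ≤ t) : E.a j t ≤ E.aPlus := by
  obtain ⟨c, C, -, hC⟩ := h.a_bdd j
  exact (le_supPlus (fun s hs => (hC s hs).2) ht).trans
    (le_ciSup (f := fun j => supPlus (E.a j)) (Set.finite_range _).bddAbove j)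

theorem A0.τ_le_maxDelay (h : E.A0) (j : Fin m) {t : ℝ} (ht : 0 ≤ t) :
    E.τ j t ≤ E.maxDelay := by
  obtain ⟨C, hC⟩ := h.τ_bdd j
  exact ((le_supPlus (fun s hs => (hC s hs).2) ht).trans
    (le_ciSup (f := fun j => supPlus (E.τ j)) (Set.finite_range _).bddAbove j)).trans
      (le_max_left _ _)

theorem A0.σ_le_maxDelay (h : E.A0) (j : Fin m) {t : ℝ} (ht : 0 ≤ t) :
    E.σ j t ≤ E.maxDelay := by
  obtain ⟨C, hC⟩ := h.σ_bdd j
  exact ((le_supPlus (fun s hs => (hC s hs).2) ht).trans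
    (le_ciSup (f := fun j => supPlus (E.σ j)) (Set.finite_range _).bddAbove j)).trans
      (le_max_right _ _)

theorem A0.τ_nonneg (h : E.A0) (j : Fin m) {t : ℝ} (ht : 0 ≤ t) : 0 ≤ E.τ j t :=
  ((h.τ_bdd j).choose_spec t ht).1

theorem A0.σ_nonneg (h : E.A0) (j : Fin m) {t : ℝ} (ht : 0 ≤ t) : 0 ≤ E.σ j t :=
  ((h.σ_bdd j).choose_spec t ht).1

theorem A0.sub_τ_mem (h : E.A0) (j : Fin m) {t : ℝ} (ht : 0 ≤ t) :
    t - E.τ j t ∈ Icc (t - E.maxDelay) t :=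
  ⟨sub_le_sub_left (h.τ_le_maxDelay j ht) t, sub_le_self t (h.τ_nonneg j ht)⟩

theorem A0.sub_σ_mem (h : E.A0) (j : Fin m) {t : ℝ} (ht : 0 ≤ t) :
    t - E.σ j t ∈ Icc (t - E.maxDelay) t :=
  ⟨sub_le_sub_left (h.σ_le_maxDelay j ht) t, sub_le_self t (h.σ_nonneg j ht)⟩

theorem A0.exists_a_lower (h : E.A0) : ∃ c > 0, ∀ j, ∀ t ≥ 0, c ≤ E.a j t := by
  choose c C hc hC using h.a_bdd
  rcases isEmpty_or_nonempty (Fin m) with he | he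
  · exact ⟨1, one_pos, fun j => he.elim j⟩
  · obtain ⟨i, hi⟩ := Finite.exists_min c
    exact ⟨c i, hc i, fun j t ht => (hi j).trans (hC j t ht).1⟩

theorem A0.a_pos (h : E.A0) (j : Fin m) {t : ℝ} (ht : 0 ≤ t) : 0 < E.a j t := by
  obtain ⟨c, hc, hca⟩ := h.exists_a_lower
  exact hc.trans_le (hca j t ht)

theorem IsPositiveEquilibrium.nonempty (h : E.A0) {K : ℝ} (hK : E.IsPositiveEquilibrium K) :
    Nonempty (Fin m) := by
  by_contra hne
  rw [not_nonempty_iff] at hne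
  have h1 := hK.2 0 le_rfl
  have h2 := h.δ_pos 0 le_rfl
  simp at h1
  linarith

theorem A0.maxDelay_nonneg [Nonempty (Fin m)] (h : E.A0) : 0 ≤ E.maxDelay :=
  (h.τ_nonneg (Classical.arbitrary _) le_rfl).trans (h.τ_le_maxDelay _ le_rfl)

/-- With `pTot_le`, this makes `p` and `δ` comparable: a bound on `∫ p` controls `∫ δ`, and
production can be measured against `δ`. -/
theorem IsPositiveEquilibrium.δ_le_pTot (h : E.A0) {K : ℝ} (hK : E.IsPositiveEquilibrium K)
    {t : ℝ} (ht : 0 ≤ t) : E.δ t ≤ E.pTot t := by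
  rw [hK.2 t ht]
  refine Finset.sum_le_sum fun j _ => mul_le_of_le_one_right (h.p_pos j t ht).le ?_
  exact Real.exp_le_one_iff.2 (by nlinarith [h.a_pos j ht, hK.1])

theorem IsPositiveEquilibrium.pTot_le (h : E.A0) {K : ℝ} (hK : E.IsPositiveEquilibrium K)
    {t : ℝ} (ht : 0 ≤ t) : E.pTot t ≤ Real.exp (E.aPlus * K) * E.δ t := by
  rw [hK.2 t ht, Finset.mul_sum]
  refine Finset.sum_le_sum fun j _ => ?_
  have h1 : 1 ≤ Real.exp (E.aPlus * K) * Real.exp (-(E.a j t) * K) := by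
    rw [← Real.exp_add]
    exact Real.one_le_exp (by nlinarith [h.a_le_aPlus j ht, hK.1])
  nlinarith [h.p_pos j t ht]

theorem pTot_continuousOn (h : E.A0) : ContinuousOn E.pTot (Ici 0) :=
  continuousOn_finsetSum _ fun j _ => h.p_cont j

theorem IsSolution.hasDerivAt {x : ℝ → ℝ} (hx : E.IsSolution x) {t : ℝ} (ht : 0 < t) :
    HasDerivAt x (E.rhs x t) t :=
  (hx.2 t ht.le).hasDerivAt (Ici_mem_nhds ht)

theorem IsSolution.continuousOn_Icc [Nonempty (Fin m)] (h : E.A0) {x : ℝ → ℝ}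
    (hx : E.IsSolution x) {s t : ℝ} (hs : 0 ≤ s) : ContinuousOn x (Icc s t) :=
  hx.1.mono fun _ hr => (neg_nonpos.2 h.maxDelay_nonneg).trans (hs.trans hr.1)

theorem neg_rhs_le_of_nonneg (h : E.A0) {x : ℝ → ℝ} {t : ℝ} (ht : 0 ≤ t)
    (hx : ∀ j, 0 ≤ x (t - E.τ j t)) : -(E.δ t * x t) ≤ E.rhs x t := by
  have : 0 ≤ ∑ j, E.p j t * x (t - E.τ j t) * Real.exp (-(E.a j t) * x (t - E.σ j t)) :=
    Finset.sum_nonneg fun j _ =>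
      mul_nonneg (mul_nonneg (h.p_pos j t ht).le (hx j)) (Real.exp_pos _).le
  unfold rhs
  linarith

/-- Upper bound of the right-hand side in terms of the equilibrium. -/
theorem rhs_le (h : E.A0) {K : ℝ} (hK : E.IsPositiveEquilibrium K) {x : ℝ → ℝ} {t B Q : ℝ}
    (ht : 0 ≤ t) (hB : 0 ≤ B) (hx : ∀ j, x (t - E.τ j t) ≤ B)
    (hQ : ∀ j, E.a j t * (K - x (t - E.σ j t)) ≤ Q) :
    E.rhs x t ≤ E.δ t * (B * Real.exp Q - x t) := by
  have : ∑ j, E.p j t * x (t - E.τ j t) * Real.exp (-(E.a j t) * x (t - E.σ j t)) ≤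
      E.δ t * (B * Real.exp Q) := by
    -- Compare term by term, using the weights `p_j e^{-a_j K}` whose sum is `δ`.
    rw [hK.2 t ht, Finset.sum_mul]
    refine Finset.sum_le_sum fun j _ => ?_
    have h1 : Real.exp (-(E.a j t) * x (t - E.σ j t)) ≤
        Real.exp (-(E.a j t) * K) * Real.exp Q := by
      rw [← Real.exp_add]
      exact Real.exp_le_exp.2 (by linarith [hQ j])
    calc _ ≤ E.p j t * B * (Real.exp (-(E.a j t) * K) * Real.exp Q) :=
          mul_le_mul (mul_le_mul_of_nonneg_left (hx j) (h.p_pos j t ht).le) h1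
            (Real.exp_pos _).le (mul_nonneg (h.p_pos j t ht).le hB)
      _ = _ := by ring
  unfold rhs
  linarith

theorem le_rhs (h : E.A0) {K : ℝ} (hK : E.IsPositiveEquilibrium K) {x : ℝ → ℝ} {t B Q : ℝ}
    (ht : 0 ≤ t) (hB : 0 ≤ B) (hx : ∀ j, B ≤ x (t - E.τ j t))
    (hQ : ∀ j, Q ≤ E.a j t * (K - x (t - E.σ j t))) :
    E.δ t * (B * Real.exp Q - x t) ≤ E.rhs x t := by
  have : E.δ t * (B * Real.exp Q) ≤
      ∑ j, E.p j t * x (t - E.τ j t) * Real.exp (-(E.a j t) * x (t - E.σ j t)) := by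
    rw [hK.2 t ht, Finset.sum_mul]
    refine Finset.sum_le_sum fun j _ => ?_
    have h1 : Real.exp (-(E.a j t) * K) * Real.exp Q ≤
        Real.exp (-(E.a j t) * x (t - E.σ j t)) := by
      rw [← Real.exp_add]
      exact Real.exp_le_exp.2 (by linarith [hQ j])
    calc _ = E.p j t * B * (Real.exp (-(E.a j t) * K) * Real.exp Q) := by ring
      _ ≤ _ := mul_le_mul (mul_le_mul_of_nonneg_left (hx j) (h.p_pos j t ht).le) h1
            (by positivity) (mul_nonneg (h.p_pos j t ht).le (hB.trans (hx j)))
  unfold rhs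
  linarith

/-! ### Positivity and comparison of values within one delay -/

/-- The first time in `[s, t]` at which a continuous function is at most `c`. -/
theorem exists_first_le {x : ℝ → ℝ} {s t c : ℝ} (hst : s ≤ t) (hx : ContinuousOn x (Icc s t))
    (hs : c < x s) (ht : x t ≤ c) : ∃ q ∈ Ioc s t, x q ≤ c ∧ ∀ r ∈ Ico s q, c < x r := by
  have hcomp : IsCompact (Icc s t ∩ x ⁻¹' Iic c) := isCompact_Icc.of_isClosed_subset
    (hx.preimage_isClosed_of_isClosed isClosed_Icc isClosed_Iic) inter_subset_left
  obtain ⟨q, ⟨hq, hqc⟩, hqmin⟩ := hcomp.exists_isLeast ⟨t, right_mem_Icc.2 hst, ht⟩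
  refine ⟨q, ⟨lt_of_le_of_ne hq.1 ?_, hq.2⟩, hqc, fun r hr => ?_⟩
  · rintro rfl
    exact absurd hqc (not_le.2 hs)
  · by_contra! hrc
    exact absurd (hqmin ⟨⟨hr.1, hr.2.le.trans hq.2⟩, hrc⟩) (not_le.2 hr.2)

/-- Up to a first zero all delayed values are nonnegative, so `x' ≥ -δ x` and `x` stays above `x(0)
e^{-∫ δ} > 0`. -/
theorem IsSolution.pos [Nonempty (Fin m)] (h : E.A0) {x : ℝ → ℝ} (hx : E.IsSolution x)
    (h0 : ∀ t ∈ Ico (-E.maxDelay) 0, 0 ≤ x t) (h0' : 0 < x 0) {t : ℝ} (ht : 0 ≤ t) :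
    0 < x t := by
  by_contra! hxt
  obtain ⟨q, hq, hxq, hlt⟩ := exists_first_le ht (hx.continuousOn_Icc h le_rfl) h0' hxt
  obtain ⟨D, hD, -⟩ := exists_primitive_Ici h.δ_cont
  have := sub_le_mul_exp_of_deriv_le (u := fun r => -x r) (u' := fun r => -E.rhs x r)
    (D := D) (d := E.δ) (B := 0) hq.1.le (hx.continuousOn_Icc h le_rfl).neg
    (fun r hr => (hD r hr.1).continuousAt.continuousWithinAt)
    (fun r hr => (hx.hasDerivAt hr.1).neg) (fun r hr => hD r hr.1.le) fun r hr => by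
      have := neg_rhs_le_of_nonneg (x := x) h hr.1.le fun j => by
        have hj := h.sub_τ_mem j hr.1.le
        rcases lt_or_ge (r - E.τ j r) 0 with hneg | hnn
        · exact h0 _ ⟨by linarith [hj.1, hr.1], hneg⟩
        · exact (hlt _ ⟨hnn, hj.2.trans_lt hr.2⟩).le
      linarith
  have h2 := mul_pos h0' (Real.exp_pos (-(D q - D 0)))
  simp only [sub_zero] at this
  linarith

/-- Values of a positive solution at times at distance at most the maximal delay are
comparable. -/
theorem IsSolution.exists_harnack [Nonempty (Fin m)] (h : E.A0) (h2 : E.A2) {K : ℝ}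
    (hK : E.IsPositiveEquilibrium K) {x : ℝ → ℝ} (hx : E.IsSolution x)
    (hpos : ∀ t ≥ 0, 0 < x t) :
    ∃ C > 0, ∃ T ≥ E.maxDelay, ∀ t ≥ T, ∀ s ∈ Icc (t - E.maxDelay) t,
      x s ≤ C * x t ∧ x t ≤ C * x s := by
  obtain ⟨M, hM1, -⟩ := EReal.lt_iff_exists_real_btwn.1 h2
  have hM := eventually_lt_of_limsup_lt hM1
  obtain ⟨P, hP, hP'⟩ := exists_primitive_Ici (pTot_continuousOn h)
  obtain ⟨D, hD, -⟩ := exists_primitive_Ici h.δ_cont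
  obtain ⟨T₀, hT₀⟩ := eventually_atTop.1 hM
  set T₁ := max T₀ (2 * E.maxDelay) with hT₁
  have hτ := h.maxDelay_nonneg
  have hp0 : ∀ t ≥ 0, 0 ≤ E.pTot t := fun t ht =>
    Finset.sum_nonneg fun j _ => (h.p_pos j t ht).le
  have hPmono : ∀ s t, 0 ≤ s → s ≤ t → P s ≤ P t := by
    intro s t hs hst
    refine monotoneOn_of_hasDerivWithinAt_nonneg (f := P) (f' := E.pTot) (convex_Icc s t)
      (fun r hr => (hP r (hs.trans hr.1)).continuousAt.continuousWithinAt)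
      (fun r hr => (hP r (hs.trans (interior_subset hr).1)).hasDerivWithinAt)
      (fun r hr => hp0 r (hs.trans (interior_subset hr).1))
      (left_mem_Icc.2 hst) (right_mem_Icc.2 hst) hst
  have hDP : ∀ s t, 0 ≤ s → s ≤ t → D t - D s ≤ P t - P s := by
    intro s t hs hst
    have := monotoneOn_of_hasDerivWithinAt_nonneg (f := fun r => P r - D r)
      (f' := fun r => E.pTot r - E.δ r) (convex_Icc s t)
      (fun r hr => ((hP r (hs.trans hr.1)).sub
        (hD r (hs.trans hr.1))).continuousAt.continuousWithinAt)
      (fun r hr => ((hP r (hs.trans (interior_subset hr).1)).sub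
        (hD r (hs.trans (interior_subset hr).1))).hasDerivWithinAt)
      (fun r hr => sub_nonneg.2 (hK.δ_le_pTot h (hs.trans (interior_subset hr).1)))
      (left_mem_Icc.2 hst) (right_mem_Icc.2 hst) hst
    simp only at this
    linarith
  have hPM : ∀ t ≥ T₁, ∀ s ∈ Icc (t - E.maxDelay) t, P t - P s ≤ M := by
    intro t ht s hs
    have h3 : E.maxDelay ≤ t := by linarith [(le_max_right T₀ (2 * E.maxDelay)).trans ht]
    have h4 := hT₀ t ((le_max_left _ _).trans ht)
    rw [hP' _ _ (sub_nonneg.2 h3) (hτ.trans h3), EReal.coe_lt_coe_iff] at h4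
    have := hPmono _ _ (sub_nonneg.2 h3) hs.1
    linarith
  -- Decay is at most exponential: `x' ≥ -δ x`, and `∫ δ ≤ ∫ p ≤ M` over the window.
  have hlow : ∀ t ≥ T₁, ∀ s ∈ Icc (t - E.maxDelay) t, x s ≤ Real.exp M * x t := by
    intro t ht s hs
    have hs1 : E.maxDelay ≤ s := by
      linarith [(le_max_right T₀ (2 * E.maxDelay)).trans ht, hs.1]
    have hs0 : 0 ≤ s := hτ.trans hs1
    have := sub_le_mul_exp_of_deriv_le (u := fun r => -x r) (u' := fun r => -E.rhs x r)
      (D := D) (d := E.δ) (B := 0) hs.2 (hx.continuousOn_Icc h hs0).neg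
      (fun r hr => (hD r (hs0.trans hr.1)).continuousAt.continuousWithinAt)
      (fun r hr => (hx.hasDerivAt (hs0.trans_lt hr.1)).neg)
      (fun r hr => hD r (hs0.trans hr.1.le)) fun r hr => by
        have hr0 := hs0.trans hr.1.le
        have := neg_rhs_le_of_nonneg (x := x) h hr0 fun j =>
          (hpos _ (by linarith [(h.sub_τ_mem j hr0).1, hr.1])).le
        linarith
    have h5 : Real.exp (-(D t - D s)) * Real.exp (D t - D s) = 1 := by
      rw [← Real.exp_add]; simp
    have h6 : x s * Real.exp (-(D t - D s)) ≤ x t := by linarith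
    have h7 := mul_le_mul_of_nonneg_right h6 (Real.exp_pos (D t - D s)).le
    rw [mul_assoc, h5, mul_one] at h7
    have h8 : Real.exp (D t - D s) ≤ Real.exp M :=
      Real.exp_le_exp.2 ((hDP s t hs0 hs.2).trans (hPM t ht s hs))
    have h9 := hpos t (hs0.trans hs.2)
    nlinarith
  refine ⟨max (Real.exp M) (Real.exp (Real.exp M * M)), lt_max_of_lt_left (Real.exp_pos _),
    T₁ + E.maxDelay, by linarith [le_max_right T₀ (2 * E.maxDelay)], fun t ht s hs => ?_⟩
  have hs1 : T₁ ≤ s := by linarith [hs.1]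
  have hs0 : 0 ≤ s := by linarith [le_max_right T₀ (2 * E.maxDelay)]
  have hxs := hpos s hs0
  have hxt := hpos t (hs0.trans hs.2)
  refine ⟨(hlow t (by linarith) s hs).trans
    (mul_le_mul_of_nonneg_right (le_max_left _ _) hxt.le), ?_⟩
  -- By `hlow` the delayed values are at most `e^M x(r)`, so `x' ≤ e^M p x`; Grönwall gives the
  -- growth factor `exp (e^M M)`.
  have := sub_le_mul_exp_of_deriv_le (u := x) (u' := fun r => E.rhs x r)
    (D := fun r => -(Real.exp M * P r)) (d := fun r => -(Real.exp M * E.pTot r)) (B := 0) hs.2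
    (hx.continuousOn_Icc h hs0)
    (fun r hr => ((hP r (hs0.trans hr.1)).const_mul _).neg.continuousAt.continuousWithinAt)
    (fun r hr => hx.hasDerivAt (hs0.trans_lt hr.1))
    (fun r hr => ((hP r (hs0.trans hr.1.le)).const_mul _).neg) fun r hr => by
      have hr0 := hs0.trans hr.1.le
      have hr1 : T₁ ≤ r := hs1.trans hr.1.le
      have hsum : ∑ j, E.p j r * x (r - E.τ j r) * Real.exp (-(E.a j r) * x (r - E.σ j r)) ≤
          E.pTot r * (Real.exp M * x r) := by
        unfold pTot
        rw [Finset.sum_mul]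
        refine Finset.sum_le_sum fun j _ => ?_
        have hj := h.sub_τ_mem j hr0
        have hj' := h.sub_σ_mem j hr0
        have hge : 2 * E.maxDelay ≤ r := (le_max_right T₀ _).trans hr1
        have hp := h.p_pos j r hr0
        have hxτ := hpos (r - E.τ j r) (by linarith [hj.1])
        have hxσ := hpos (r - E.σ j r) (by linarith [hj'.1])
        have he : Real.exp (-(E.a j r) * x (r - E.σ j r)) ≤ 1 :=
          Real.exp_le_one_iff.2 (by nlinarith [h.a_pos j hr0])
        exact (mul_le_of_le_one_right (mul_pos hp hxτ).le he).trans
          (mul_le_mul_of_nonneg_left (hlow r hr1 _ hj) hp.le)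
      have hδ := mul_pos (h.δ_pos r hr0) (hpos r hr0)
      unfold rhs
      linarith
  have h8 : Real.exp (-(-(Real.exp M * P t) - -(Real.exp M * P s))) ≤
      Real.exp (Real.exp M * M) := by
    refine Real.exp_le_exp.2 ?_
    have := mul_le_mul_of_nonneg_left (hPM t (by linarith) s hs) (Real.exp_pos M).le
    linarith
  simp only [sub_zero] at this
  calc x t ≤ _ := this
    _ ≤ x s * Real.exp (Real.exp M * M) := mul_le_mul_of_nonneg_left h8 hxs.le
    _ ≤ _ := by
      rw [mul_comm]
      exact mul_le_mul_of_nonneg_right (le_max_right _ _) hxs.le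

/-! ### Eventual bounds above and away from zero -/

theorem A0.exists_primitive_δ (h : E.A0) (h3 : E.A3) : ∃ D : ℝ → ℝ,
    (∀ t ≥ 0, HasDerivAt D (E.δ t) t) ∧
      (∀ s t, 0 ≤ s → 0 ≤ t → ∫ r in s..t, E.δ r = D t - D s) ∧ Tendsto D atTop atTop := by
  obtain ⟨D, hD, hD'⟩ := exists_primitive_Ici h.δ_cont
  refine ⟨D, hD, hD', ?_⟩
  have : Tendsto (fun t => (∫ s in (0 : ℝ)..t, E.δ s) + D 0) atTop atTop :=
    tendsto_atTop_add_const_right _ _ h3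
  refine this.congr' ?_
  filter_upwards [eventually_ge_atTop 0] with t ht
  rw [hD' 0 t le_rfl ht]
  ring

/-- If `x(t) > L`, all delayed values exceed `L / C`; the exponential then reduces production to at
most half the loss, so `x' ≤ -(L/2) δ`. -/
theorem IsSolution.eventually_bounded_above [Nonempty (Fin m)] (h : E.A0) (h2 : E.A2)
    (h3 : E.A3) {K : ℝ} (hK : E.IsPositiveEquilibrium K) {x : ℝ → ℝ} (hx : E.IsSolution x)
    (hpos : ∀ t ≥ 0, 0 < x t) : ∃ L, ∀ᶠ t in atTop, x t ≤ L := by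
  obtain ⟨C, hC, T, hT, hCT⟩ := hx.exists_harnack h h2 hK hpos
  obtain ⟨c, hc, hca⟩ := h.exists_a_lower
  obtain ⟨D, hD, -, hlim⟩ := h.exists_primitive_δ h3
  have hτ := h.maxDelay_nonneg
  set Cp := Real.exp (E.aPlus * K) with hCp
  have hCp0 : 0 < Cp := Real.exp_pos _
  -- Chosen so that `c L / C = 2 C Cp`; then `y e^{-y} ≤ 1` at `y = 2 C Cp` is the bound `hLexp`.
  set L := 2 * C * C * Cp / c with hL
  have hL0 : 0 < L := by positivity
  have hLexp : C * Cp * Real.exp (-(c * (L / C))) ≤ 1 / 2 := by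
    have h4 : c * (L / C) = 2 * C * Cp := by rw [hL]; field_simp
    have h5 := Real.add_one_le_exp (2 * C * Cp)
    have h6 : Real.exp (2 * C * Cp) * Real.exp (-(2 * C * Cp)) = 1 := by
      rw [← Real.exp_add]; simp
    rw [h4]
    nlinarith [Real.exp_pos (-(2 * C * Cp))]
  refine ⟨L, eventually_le_of_deriv_le (u' := E.rhs x) (D := D) (d := E.δ)
    (T := max (T + E.maxDelay) 1)
    (half_pos hL0) (fun t ht => hx.hasDerivAt (one_pos.trans_le ((le_max_right _ _).trans ht)))
    (fun t ht => hD t (zero_le_one.trans ((le_max_right _ _).trans ht)))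
    (fun t ht => (h.δ_pos t (zero_le_one.trans ((le_max_right _ _).trans ht))).le) hlim
    fun t ht hLt => ?_⟩
  have ht0 : 0 ≤ t := zero_le_one.trans ((le_max_right _ _).trans ht)
  have htT : T + E.maxDelay ≤ t := (le_max_left _ _).trans ht
  have hxt := hpos t ht0
  have hsum : ∑ j, E.p j t * x (t - E.τ j t) * Real.exp (-(E.a j t) * x (t - E.σ j t)) ≤
      E.pTot t * (C * x t * Real.exp (-(c * (L / C)))) := by
    unfold pTot
    rw [Finset.sum_mul]
    refine Finset.sum_le_sum fun j _ => ?_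
    have hp := h.p_pos j t ht0
    have h7 := (hCT t (by linarith) _ (h.sub_τ_mem j ht0)).1
    have h8 := (hCT t (by linarith) _ (h.sub_σ_mem j ht0)).2
    have h9 : L / C ≤ x (t - E.σ j t) := by
      rw [div_le_iff₀ hC]; linarith
    have h10 : Real.exp (-(E.a j t) * x (t - E.σ j t)) ≤ Real.exp (-(c * (L / C))) := by
      refine Real.exp_le_exp.2 ?_
      have := mul_le_mul (hca j t ht0) h9 (by positivity) (h.a_pos j ht0).le
      linarith
    rw [mul_assoc]
    refine mul_le_mul_of_nonneg_left ?_ hp.le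
    exact mul_le_mul h7 h10 (Real.exp_pos _).le (by positivity)
  have hδ := h.δ_pos t ht0
  have h11 : E.pTot t * (C * x t * Real.exp (-(c * (L / C)))) ≤ E.δ t * x t * (1 / 2) :=
    calc _ ≤ Cp * E.δ t * (C * x t * Real.exp (-(c * (L / C)))) :=
          mul_le_mul_of_nonneg_right (hK.pTot_le h ht0) (by positivity)
      _ = E.δ t * x t * (C * Cp * Real.exp (-(c * (L / C)))) := by ring
      _ ≤ _ := mul_le_mul_of_nonneg_left hLexp (by positivity)
  have h12 := mul_lt_mul_of_pos_left hLt hδ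
  unfold rhs
  linarith

/-- At a first time `q` with `x(q) ≤ l`, recent values are at least `x(q)` yet below `K`. Production
then strictly exceeds loss, contradicting `x'(q) ≤ 0`. -/
theorem IsSolution.eventually_bounded_below [Nonempty (Fin m)] (h : E.A0) (h2 : E.A2)
    {K : ℝ} (hK : E.IsPositiveEquilibrium K) {x : ℝ → ℝ} (hx : E.IsSolution x)
    (hpos : ∀ t ≥ 0, 0 < x t) : ∃ l > 0, ∀ᶠ t in atTop, l ≤ x t := by
  obtain ⟨C, hC, T, hT, hCT⟩ := hx.exists_harnack h h2 hK hpos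
  have hτ := h.maxDelay_nonneg
  obtain ⟨w, hw, hwmin⟩ := (isCompact_Icc (a := T) (b := T + E.maxDelay)).exists_isMinOn
    ⟨T, le_rfl, by linarith⟩ (hx.continuousOn_Icc h (hτ.trans hT))
  have hxw : 0 < x w := hpos w (hτ.trans (hT.trans hw.1))
  -- Being below the minimum on `[T, T + τ]` places the whole delay window of `q` after `T`; `C l <
  -- K` keeps the delayed values at `q` below `K`.
  set l := min (x w) (K / C) / 2 with hl
  have hl0 : 0 < l := half_pos (lt_min hxw (div_pos hK.1 hC))
  have hlw : l < x w := by linarith [min_le_left (x w) (K / C)]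
  have hlK : C * l < K := by
    have h4 : l < K / C := by linarith [min_le_right (x w) (K / C)]
    rw [lt_div_iff₀ hC] at h4
    linarith
  refine ⟨l, hl0, ?_⟩
  filter_upwards [eventually_ge_atTop T] with t ht
  by_contra! hxt
  obtain ⟨q, hq, hxq, hlt⟩ := exists_first_le ht (hx.continuousOn_Icc h (hτ.trans hT))
    (hlw.trans_le (hwmin ⟨le_rfl, by linarith⟩)) hxt.le
  have hqT : T + E.maxDelay < q := by
    by_contra! hcon
    exact absurd hxq (not_le.2 (hlw.trans_le (hwmin ⟨hq.1.le, hcon⟩)))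
  have hq0 : 0 < q := by linarith
  have hxq0 := hpos q hq0.le
  have hge : ∀ s ∈ Icc (q - E.maxDelay) q, x q ≤ x s := fun s hs => by
    rcases hs.2.eq_or_lt with rfl | hlt'
    · exact le_rfl
    · exact hxq.trans (hlt s ⟨by linarith [hs.1], hlt'⟩).le
  have hder : E.rhs x q ≤ 0 := by
    have hslope := (hasDerivWithinAt_iff_tendsto_slope' (s := Iio q) self_notMem_Iio).1
      (hx.hasDerivAt hq0).hasDerivWithinAt
    refine le_of_tendsto hslope ?_
    filter_upwards [Ioo_mem_nhdsLT hq.1] with s hs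
    rw [slope_def_field]
    exact div_nonpos_of_nonneg_of_nonpos
      (sub_nonneg.2 (hxq.trans (hlt s ⟨hs.1.le, hs.2⟩).le)) (sub_nonpos.2 hs.2.le)
  have hrhs : 0 < E.rhs x q := by
    have hsum : E.δ q * x q <
        ∑ j, E.p j q * x (q - E.τ j q) * Real.exp (-(E.a j q) * x (q - E.σ j q)) := by
      rw [hK.2 q hq0.le, Finset.sum_mul]
      refine Finset.sum_lt_sum_of_nonempty Finset.univ_nonempty fun j _ => ?_
      have hp := h.p_pos j q hq0.le
      have hσ := (hCT q (by linarith) _ (h.sub_σ_mem j hq0.le)).1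
      have hσ' : x (q - E.σ j q) < K := by nlinarith
      have hexp : Real.exp (-(E.a j q) * K) < Real.exp (-(E.a j q) * x (q - E.σ j q)) :=
        Real.exp_lt_exp.2 (by nlinarith [h.a_pos j hq0.le])
      have hxτ := hge _ (h.sub_τ_mem j hq0.le)
      calc E.p j q * Real.exp (-(E.a j q) * K) * x q
          = E.p j q * x q * Real.exp (-(E.a j q) * K) := by ring
        _ < E.p j q * x q * Real.exp (-(E.a j q) * x (q - E.σ j q)) :=
          mul_lt_mul_of_pos_left hexp (by positivity)
        _ ≤ _ := mul_le_mul_of_nonneg_right (mul_le_mul_of_nonneg_left hxτ hp.le)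
          (Real.exp_pos _).le
    unfold rhs
    linarith
  linarith

/-! ### Improving asymptotic bounds -/

theorem eventually_bounds_on_delay (h : E.A0) {x : ℝ → ℝ} {l B : ℝ}
    (hx : ∀ᶠ t in atTop, l ≤ x t ∧ x t ≤ B) :
    ∃ T ≥ 0, ∀ t ≥ T, ∀ j, (l ≤ x (t - E.τ j t) ∧ x (t - E.τ j t) ≤ B) ∧
      l ≤ x (t - E.σ j t) ∧ x (t - E.σ j t) ≤ B := by
  obtain ⟨T, hT⟩ := eventually_atTop.1 hx
  refine ⟨max 0 (T + E.maxDelay), le_max_left _ _, fun t ht j => ?_⟩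
  have h0 : 0 ≤ t := (le_max_left _ _).trans ht
  have h1 : T + E.maxDelay ≤ t := (le_max_right _ _).trans ht
  exact ⟨hT _ (by linarith [(h.sub_τ_mem j h0).1]), hT _ (by linarith [(h.sub_σ_mem j h0).1])⟩

/-- Improvement of an eventual upper bound. -/
theorem IsSolution.eventually_le [Nonempty (Fin m)] (h : E.A0) {K : ℝ}
    (hK : E.IsPositiveEquilibrium K) {x D : ℝ → ℝ} (hx : E.IsSolution x)
    (hD : ∀ t ≥ 0, HasDerivAt D (E.δ t) t) (hlim : Tendsto D atTop atTop)
    {l B z c η A : ℝ} (hlK : l ≤ K) (hKB : K ≤ B)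
    (hb : ∀ᶠ t in atTop, l ≤ x t ∧ x t ≤ B)
    (hz : ∀ᶠ t in atTop, ∀ j, D t - D (t - E.σ j t) ≤ z)
    (hc : ∀ j, ∀ t ≥ 0, c ≤ E.a j t) (hη : 0 < η)
    (hA : K * Real.exp (-z) + B * Real.exp (E.aPlus * (K - l)) * (1 - Real.exp (-z)) + η ≤ A)
    (hA' : B * Real.exp (-(c * η)) < A) : ∀ᶠ t in atTop, x t ≤ A := by
  obtain ⟨T, hT, hb⟩ := eventually_bounds_on_delay h hb
  obtain ⟨Tz, hz⟩ := eventually_atTop.1 hz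
  have hτ := h.maxDelay_nonneg
  have hB : 0 < B := hK.1.trans_le hKB
  have hDmono : ∀ s t, 0 ≤ s → s ≤ t → D s ≤ D t := by
    intro s t hs hst
    exact monotoneOn_of_hasDerivWithinAt_nonneg (f := D) (f' := E.δ) (convex_Icc s t)
      (fun r hr => (hD r (hs.trans hr.1)).continuousAt.continuousWithinAt)
      (fun r hr => (hD r (hs.trans (interior_subset hr).1)).hasDerivWithinAt)
      (fun r hr => (h.δ_pos r (hs.trans (interior_subset hr).1)).le)
      (left_mem_Icc.2 hst) (right_mem_Icc.2 hst) hst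
  have haPlus : 0 ≤ E.aPlus := (h.a_pos (Classical.arbitrary _) le_rfl).le.trans
    (h.a_le_aPlus _ le_rfl)
  set B₁ := B * Real.exp (E.aPlus * (K - l)) with hB₁
  have hKB₁ : K ≤ B₁ := hKB.trans (le_mul_of_one_le_right hB.le
    (Real.one_le_exp (mul_nonneg haPlus (sub_nonneg.2 hlK))))
  refine eventually_le_of_deriv_le (u' := E.rhs x) (D := D) (d := E.δ)
    (T := max (max 1 Tz) (T + E.maxDelay)) (sub_pos.2 hA')
    (fun t ht => hx.hasDerivAt (one_pos.trans_le ((le_max_left _ _).trans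
      ((le_max_left _ _).trans ht))))
    (fun t ht => hD t (zero_le_one.trans ((le_max_left _ _).trans ((le_max_left _ _).trans ht))))
    (fun t ht => (h.δ_pos t (zero_le_one.trans ((le_max_left _ _).trans
      ((le_max_left _ _).trans ht)))).le) hlim fun t ht hAt => ?_
  have ht1 : 1 ≤ t := (le_max_left _ _).trans ((le_max_left _ _).trans ht)
  have ht0 : 0 ≤ t := zero_le_one.trans ht1
  have htz : Tz ≤ t := (le_max_right _ _).trans ((le_max_left _ _).trans ht)
  have htT : T + E.maxDelay ≤ t := (le_max_right _ _).trans ht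
  -- If some delayed value were at most `K + η`, relaxation towards `B₁` from that time would give
  -- `x t ≤ A` by `hA`. Otherwise all of them exceed `K + η`, and `x' ≤ -(A - B e^{-cη}) δ`.
  have hσ : ∀ j, K + η < x (t - E.σ j t) := by
    intro j
    by_contra! hcon
    have hj := h.sub_σ_mem j ht0
    have hs : T ≤ t - E.σ j t := by linarith [hj.1]
    have hs0 : 0 ≤ t - E.σ j t := hT.trans hs
    have hg := sub_le_mul_exp_of_deriv_le (u := x) (u' := E.rhs x) (D := D) (d := E.δ)
      (B := B₁) hj.2 (hx.continuousOn_Icc h hs0)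
      (fun r hr => (hD r (hs0.trans hr.1)).continuousAt.continuousWithinAt)
      (fun r hr => hx.hasDerivAt (hs0.trans_lt hr.1))
      (fun r hr => hD r (hs0.trans hr.1.le)) fun r hr => by
        have hr0 := hs0.trans hr.1.le
        have hbr := hb r (hs.trans hr.1.le)
        refine rhs_le h hK hr0 hB.le (fun i => (hbr i).1.2) fun i => ?_
        calc _ ≤ E.a i r * (K - l) := mul_le_mul_of_nonneg_left
              (sub_le_sub_left (hbr i).2.1 K) (h.a_pos i hr0).le
          _ ≤ _ := mul_le_mul_of_nonneg_right (h.a_le_aPlus i hr0) (sub_nonneg.2 hlK)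
    have hq1 : Real.exp (-(D t - D (t - E.σ j t))) ≤ 1 :=
      Real.exp_le_one_iff.2 (by linarith [hDmono _ _ hs0 hj.2])
    have hq2 : Real.exp (-z) ≤ Real.exp (-(D t - D (t - E.σ j t))) :=
      Real.exp_le_exp.2 (neg_le_neg (hz t htz j))
    have hq0 := Real.exp_pos (-(D t - D (t - E.σ j t)))
    have h1 := mul_le_mul_of_nonneg_right (sub_le_sub_right hcon B₁) hq0.le
    have h2 := mul_le_mul_of_nonneg_left hq2 (sub_nonneg.2 hKB₁)
    have h3 := mul_le_mul_of_nonneg_left hq1 hη.le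
    linarith
  have hbt := hb t (by linarith)
  have hr := rhs_le (x := x) (Q := -(c * η)) h hK ht0 hB.le (fun j => (hbt j).1.2) fun j => by
    have h1 := hc j t ht0
    have h2 := h.a_pos j ht0
    nlinarith [hσ j]
  have h4 := mul_le_mul_of_nonneg_left hAt.le (h.δ_pos t ht0).le
  linarith

/-- Improvement of an eventual lower bound. -/
theorem IsSolution.eventually_ge [Nonempty (Fin m)] (h : E.A0) {K : ℝ}
    (hK : E.IsPositiveEquilibrium K) {x D : ℝ → ℝ} (hx : E.IsSolution x)
    (hD : ∀ t ≥ 0, HasDerivAt D (E.δ t) t) (hlim : Tendsto D atTop atTop)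
    {l B z c η A : ℝ} (hl : 0 < l) (hlK : l ≤ K) (hKB : K ≤ B)
    (hb : ∀ᶠ t in atTop, l ≤ x t ∧ x t ≤ B)
    (hz : ∀ᶠ t in atTop, ∀ j, D t - D (t - E.σ j t) ≤ z)
    (hc : ∀ j, ∀ t ≥ 0, c ≤ E.a j t) (hη : 0 < η)
    (hA : A ≤ K * Real.exp (-z) + l * Real.exp (-(E.aPlus * (B - K))) * (1 - Real.exp (-z)) - η)
    (hA' : A < l * Real.exp (c * η)) : ∀ᶠ t in atTop, A ≤ x t := by
  obtain ⟨T, hT, hb⟩ := eventually_bounds_on_delay h hb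
  obtain ⟨Tz, hz⟩ := eventually_atTop.1 hz
  have hτ := h.maxDelay_nonneg
  have hDmono : ∀ s t, 0 ≤ s → s ≤ t → D s ≤ D t := by
    intro s t hs hst
    exact monotoneOn_of_hasDerivWithinAt_nonneg (f := D) (f' := E.δ) (convex_Icc s t)
      (fun r hr => (hD r (hs.trans hr.1)).continuousAt.continuousWithinAt)
      (fun r hr => (hD r (hs.trans (interior_subset hr).1)).hasDerivWithinAt)
      (fun r hr => (h.δ_pos r (hs.trans (interior_subset hr).1)).le)
      (left_mem_Icc.2 hst) (right_mem_Icc.2 hst) hst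
  have haPlus : 0 ≤ E.aPlus := (h.a_pos (Classical.arbitrary _) le_rfl).le.trans
    (h.a_le_aPlus _ le_rfl)
  set L₁ := l * Real.exp (-(E.aPlus * (B - K))) with hL₁
  have hKL₁ : L₁ ≤ K := (mul_le_of_le_one_right hl.le (Real.exp_le_one_iff.2
    (neg_nonpos.2 (mul_nonneg haPlus (sub_nonneg.2 hKB))))).trans hlK
  have hneg := eventually_le_of_deriv_le (u := fun t => -x t) (u' := fun t => -E.rhs x t)
    (D := D) (d := E.δ) (A := -A)
    (T := max (max 1 Tz) (T + E.maxDelay)) (sub_pos.2 hA')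
    (fun t ht => (hx.hasDerivAt (one_pos.trans_le ((le_max_left _ _).trans
      ((le_max_left _ _).trans ht)))).neg)
    (fun t ht => hD t (zero_le_one.trans ((le_max_left _ _).trans ((le_max_left _ _).trans ht))))
    (fun t ht => (h.δ_pos t (zero_le_one.trans ((le_max_left _ _).trans
      ((le_max_left _ _).trans ht)))).le) hlim fun t ht hAt => by
    have ht1 : 1 ≤ t := (le_max_left _ _).trans ((le_max_left _ _).trans ht)
    have ht0 : 0 ≤ t := zero_le_one.trans ht1
    have htz : Tz ≤ t := (le_max_right _ _).trans ((le_max_left _ _).trans ht)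
    have htT : T + E.maxDelay ≤ t := (le_max_right _ _).trans ht
    have hσ : ∀ j, x (t - E.σ j t) < K - η := by
      intro j
      by_contra! hcon
      have hj := h.sub_σ_mem j ht0
      have hs : T ≤ t - E.σ j t := by linarith [hj.1]
      have hs0 : 0 ≤ t - E.σ j t := hT.trans hs
      have hg := sub_le_mul_exp_of_deriv_le (u := fun r => -x r) (u' := fun r => -E.rhs x r)
        (D := D) (d := E.δ) (B := -L₁) hj.2 (hx.continuousOn_Icc h hs0).neg
        (fun r hr => (hD r (hs0.trans hr.1)).continuousAt.continuousWithinAt)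
        (fun r hr => (hx.hasDerivAt (hs0.trans_lt hr.1)).neg)
        (fun r hr => hD r (hs0.trans hr.1.le)) fun r hr => by
          have hr0 := hs0.trans hr.1.le
          have hbr := hb r (hs.trans hr.1.le)
          have := le_rhs (x := x) (Q := -(E.aPlus * (B - K))) h hK hr0 hl.le
            (fun i => (hbr i).1.1) fun i => by
              have h5 : E.a i r * (x (r - E.σ i r) - K) ≤ E.a i r * (B - K) :=
                mul_le_mul_of_nonneg_left (sub_le_sub_right (hbr i).2.2 K) (h.a_pos i hr0).le
              have h6 : E.a i r * (B - K) ≤ E.aPlus * (B - K) :=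
                mul_le_mul_of_nonneg_right (h.a_le_aPlus i hr0) (sub_nonneg.2 hKB)
              linarith
          rw [← hL₁] at this
          linarith
      have hq1 : Real.exp (-(D t - D (t - E.σ j t))) ≤ 1 :=
        Real.exp_le_one_iff.2 (by linarith [hDmono _ _ hs0 hj.2])
      have hq2 : Real.exp (-z) ≤ Real.exp (-(D t - D (t - E.σ j t))) :=
        Real.exp_le_exp.2 (neg_le_neg (hz t htz j))
      have hq0 := Real.exp_pos (-(D t - D (t - E.σ j t)))
      have h1 := mul_le_mul_of_nonneg_right (sub_le_sub_right hcon L₁) hq0.le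
      have h2 := mul_le_mul_of_nonneg_left hq2 (sub_nonneg.2 hKL₁)
      have h3 := mul_le_mul_of_nonneg_left hq1 hη.le
      linarith
    have hbt := hb t (by linarith)
    have hr := le_rhs (x := x) (Q := c * η) h hK ht0 hl.le (fun j => (hbt j).1.1) fun j => by
      have h1 := hc j t ht0
      have h2 := h.a_pos j ht0
      nlinarith [hσ j]
    have h4 := mul_le_mul_of_nonneg_left (neg_lt_neg_iff.1 hAt).le (h.δ_pos t ht0).le
    linarith
  filter_upwards [hneg] with t ht using neg_le_neg_iff.1 ht

/-- The inequality satisfied by the upper limit. -/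
theorem IsSolution.exists_lt_eventually_le [Nonempty (Fin m)] (h : E.A0) {K : ℝ}
    (hK : E.IsPositiveEquilibrium K) {x D : ℝ → ℝ} (hx : E.IsSolution x)
    (hD : ∀ t ≥ 0, HasDerivAt D (E.δ t) t) (hlim : Tendsto D atTop atTop)
    {l M z : ℝ} (hl : 0 < l) (hlK : l ≤ K) (hKM : K ≤ M)
    (hM : ∀ ε > 0, ∀ᶠ t in atTop, x t ≤ M + ε) (hl' : ∀ ε > 0, ∀ᶠ t in atTop, l - ε ≤ x t)
    (hz : ∀ ε > 0, ∀ᶠ t in atTop, ∀ j, D t - D (t - E.σ j t) ≤ z + ε)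
    (hlt : K * Real.exp (-z) + M * Real.exp (E.aPlus * (K - l)) * (1 - Real.exp (-z)) < M) :
    ∃ A < M, ∀ᶠ t in atTop, x t ≤ A := by
  obtain ⟨c, hc, hca⟩ := h.exists_a_lower
  -- The strict gap pays for `η`; both conditions of `eventually_le` are then strict at `ε = 0` with
  -- `A` replaced by `M`, and survive for small `ε > 0` by continuity.
  obtain ⟨η, hη, hη'⟩ := exists_between (sub_pos.2 hlt)
  have hM0 : 0 < M := hK.1.trans_le hKM
  have hF : Continuous fun ε : ℝ => K * Real.exp (-(z + ε)) +
      (M + ε) * Real.exp (E.aPlus * (K - (l - ε))) * (1 - Real.exp (-(z + ε))) + η := by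
    fun_prop
  have hG : Continuous fun ε : ℝ => (M + ε) * Real.exp (-(c * η)) := by fun_prop
  have e1 := (hF.tendsto 0).eventually_lt_const (u := M) (by
    simp only [add_zero, sub_zero]; linarith)
  have e2 := (hG.tendsto 0).eventually_lt_const (u := M) (by
    simp only [add_zero]
    exact mul_lt_of_lt_one_right hM0 (Real.exp_lt_one_iff.2 (neg_neg_of_pos (mul_pos hc hη))))
  have e3 : ∀ᶠ ε : ℝ in 𝓝 0, ε < l := eventually_lt_nhds hl
  obtain ⟨ε, ⟨h1, h2, h3⟩, hε⟩ := (((e1.and (e2.and e3)).filter_mono nhdsWithin_le_nhds).and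
    (self_mem_nhdsWithin (a := (0 : ℝ)) (s := Ioi 0))).exists
  have hε : 0 < ε := hε
  obtain ⟨A, hA, hAM⟩ := exists_between (max_lt h1 h2)
  exact ⟨A, hAM, hx.eventually_le h hK hD hlim (by linarith) (by linarith)
    ((hl' ε hε).and (hM ε hε)) (hz ε hε) hca hη ((le_max_left _ _).trans hA.le)
    ((le_max_right _ _).trans_lt hA)⟩

/-- The inequality satisfied by the lower limit. -/
theorem IsSolution.exists_gt_eventually_ge [Nonempty (Fin m)] (h : E.A0) {K : ℝ}
    (hK : E.IsPositiveEquilibrium K) {x D : ℝ → ℝ} (hx : E.IsSolution x)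
    (hD : ∀ t ≥ 0, HasDerivAt D (E.δ t) t) (hlim : Tendsto D atTop atTop)
    {l M z : ℝ} (hl : 0 < l) (hlK : l ≤ K) (hKM : K ≤ M)
    (hM : ∀ ε > 0, ∀ᶠ t in atTop, x t ≤ M + ε) (hl' : ∀ ε > 0, ∀ᶠ t in atTop, l - ε ≤ x t)
    (hz : ∀ ε > 0, ∀ᶠ t in atTop, ∀ j, D t - D (t - E.σ j t) ≤ z + ε)
    (hlt : l < K * Real.exp (-z) + l * Real.exp (-(E.aPlus * (M - K))) * (1 - Real.exp (-z))) :
    ∃ A > l, ∀ᶠ t in atTop, A ≤ x t := by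
  obtain ⟨c, hc, hca⟩ := h.exists_a_lower
  obtain ⟨η, hη, hη'⟩ := exists_between (sub_pos.2 hlt)
  have hF : Continuous fun ε : ℝ => K * Real.exp (-(z + ε)) +
      (l - ε) * Real.exp (-(E.aPlus * (M + ε - K))) * (1 - Real.exp (-(z + ε))) - η := by
    fun_prop
  have hG : Continuous fun ε : ℝ => (l - ε) * Real.exp (c * η) := by fun_prop
  have e1 := (hF.tendsto 0).eventually_const_lt (u := l) (by
    simp only [add_zero, sub_zero]; linarith)
  have e2 := (hG.tendsto 0).eventually_const_lt (u := l) (by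
    simp only [sub_zero]
    exact lt_mul_of_one_lt_right hl (Real.one_lt_exp_iff.2 (mul_pos hc hη)))
  have e3 : ∀ᶠ ε : ℝ in 𝓝 0, ε < l := eventually_lt_nhds hl
  obtain ⟨ε, ⟨h1, h2, h3⟩, hε⟩ := (((e1.and (e2.and e3)).filter_mono nhdsWithin_le_nhds).and
    (self_mem_nhdsWithin (a := (0 : ℝ)) (s := Ioi 0))).exists
  have hε : 0 < ε := hε
  obtain ⟨A, hlA, hA⟩ := exists_between (lt_min h1 h2)
  exact ⟨A, hlA, hx.eventually_ge h hK hD hlim (sub_pos.2 h3) (by linarith) (by linarith)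
    ((hl' ε hε).and (hM ε hε)) (hz ε hε) hca hη (hA.le.trans (min_le_left _ _))
    (hA.trans_le (min_le_right _ _))⟩

/-! ### Convergence to the equilibrium -/

/-- Over one delay `σ j`, the integral of `δ` is eventually at most `ζ⁺ + ε`. -/
theorem eventually_integral_le [Nonempty (Fin m)] (h : E.A0) (h2 : E.A2) {K : ℝ}
    (hK : E.IsPositiveEquilibrium K) {D : ℝ → ℝ}
    (hD : ∀ s t, 0 ≤ s → 0 ≤ t → ∫ r in s..t, E.δ r = D t - D s) {ε : ℝ} (hε : 0 < ε) :
    ∀ᶠ t in atTop, ∀ j, D t - D (t - E.σ j t) ≤ E.zetaPlus + ε := by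
  obtain ⟨M, hM1, -⟩ := EReal.lt_iff_exists_real_btwn.1 h2
  have hM := eventually_lt_of_limsup_lt hM1
  have hτ := h.maxDelay_nonneg
  have hp0 : ∀ t ≥ 0, 0 ≤ E.pTot t := fun t ht =>
    Finset.sum_nonneg fun j _ => (h.p_pos j t ht).le
  have hint : ∀ f : ℝ → ℝ, ContinuousOn f (Ici 0) → ∀ s t, 0 ≤ s → s ≤ t →
      IntervalIntegrable f MeasureTheory.volume s t := fun f hf s t hs hst =>
    (hf.mono (by rw [uIcc_of_le hst]; exact fun r hr => hs.trans hr.1)).intervalIntegrable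
  refine eventually_all.2 fun j => ?_
  -- The real `limsup` in `zetaPlus` bounds the integrals only once they are known to be bounded
  -- above; here `∫ δ ≤ ∫ p` over the full delay window.
  have hbdd : IsBoundedUnder (· ≤ ·) atTop (fun t : ℝ => ∫ s in (t - E.σ j t)..t, E.δ s) := by
    refine ⟨M, ?_⟩
    rw [eventually_map]
    filter_upwards [hM, eventually_ge_atTop E.maxDelay] with t ht htτ
    rw [EReal.coe_lt_coe_iff] at ht
    have ht0 := hτ.trans htτ
    have hj := h.sub_σ_mem j ht0
    have hs0 : 0 ≤ t - E.maxDelay := sub_nonneg.2 htτ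
    refine le_trans ?_ ht.le
    calc ∫ s in (t - E.σ j t)..t, E.δ s ≤ ∫ s in (t - E.σ j t)..t, E.pTot s :=
          intervalIntegral.integral_mono_on hj.2 (hint _ h.δ_cont _ _ (hs0.trans hj.1) hj.2)
            (hint _ (pTot_continuousOn h) _ _ (hs0.trans hj.1) hj.2)
            fun r hr => hK.δ_le_pTot h ((hs0.trans hj.1).trans hr.1)
      _ ≤ _ := by
        rw [← intervalIntegral.integral_add_adjacent_intervals
          (hint _ (pTot_continuousOn h) _ _ hs0 hj.1)
          (hint _ (pTot_continuousOn h) _ _ (hs0.trans hj.1) hj.2)]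
        exact le_add_of_nonneg_left (intervalIntegral.integral_nonneg hj.1
          fun r hr => hp0 r (hs0.trans hr.1))
  have hle : limsup (fun t : ℝ => ∫ s in (t - E.σ j t)..t, E.δ s) atTop ≤ E.zetaPlus :=
    le_ciSup (f := fun j => limsup (fun t : ℝ => ∫ s in (t - E.σ j t)..t, E.δ s) atTop)
      (Set.finite_range _).bddAbove j
  filter_upwards [eventually_lt_of_limsup_lt (hle.trans_lt (lt_add_of_pos_right _ hε)) hbdd,
    eventually_ge_atTop E.maxDelay] with t ht htτ
  have ht0 := hτ.trans htτ
  rw [hD _ _ ((sub_nonneg.2 htτ).trans (h.sub_σ_mem j ht0).1) ht0] at ht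
  exact ht.le

theorem IsSolution.tendsto_equilibrium [Nonempty (Fin m)] (h : E.A0) (h2 : E.A2) (h3 : E.A3)
    {K : ℝ} (hK : E.IsPositiveEquilibrium K)
    (hK2 : E.aPlus * K * (Real.exp E.zetaPlus - 1) ≤ 1) {x : ℝ → ℝ} (hx : E.IsSolution x)
    (hpos : ∀ t ≥ 0, 0 < x t) : Tendsto x atTop (𝓝 K) := by
  obtain ⟨D, hD, hD', hlim⟩ := h.exists_primitive_δ h3
  obtain ⟨B, hB⟩ := hx.eventually_bounded_above h h2 h3 hK hpos
  obtain ⟨b, hb, hbx⟩ := hx.eventually_bounded_below h h2 hK hpos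
  have hle : IsBoundedUnder (· ≤ ·) atTop x := ⟨B, hB⟩
  have hge : IsBoundedUnder (· ≥ ·) atTop x := ⟨b, hbx⟩
  have haPlus : 0 < E.aPlus := (h.a_pos (Classical.arbitrary _) le_rfl).trans_le
    (h.a_le_aPlus _ le_rfl)
  -- Truncating at `K` gives `l ≤ K ≤ M` without distinguishing whether `x` oscillates about `K`.
  -- Likewise `z ≥ 0` is obtained by truncating `ζ⁺` at `0`.
  set M := max (limsup x atTop) K with hM
  set l := min (liminf x atTop) K with hl
  set z := max E.zetaPlus 0 with hz
  have hl0 : 0 < l := lt_min (hb.trans_le (le_liminf_of_le hle.isCoboundedUnder_ge hbx)) hK.1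
  have hMε : ∀ ε > 0, ∀ᶠ t in atTop, x t ≤ M + ε := fun ε hε =>
    (eventually_lt_of_limsup_lt ((le_max_left _ K).trans_lt (lt_add_of_pos_right M hε))
      hle).mono fun _ => le_of_lt
  have hlε : ∀ ε > 0, ∀ᶠ t in atTop, l - ε ≤ x t := fun ε hε =>
    (eventually_lt_of_lt_liminf ((sub_lt_self l hε).trans_le (min_le_left _ K))
      hge).mono fun _ => le_of_lt
  have hzε : ∀ ε > 0, ∀ᶠ t in atTop, ∀ j, D t - D (t - E.σ j t) ≤ z + ε := fun ε hε =>
    (eventually_integral_le h h2 hK hD' hε).mono fun t ht j =>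
      (ht j).trans (add_le_add_left (le_max_left _ _) ε)
  have hzK : E.aPlus * K * (Real.exp z - 1) ≤ 1 := by
    rcases le_total E.zetaPlus 0 with h0 | h0
    · simp [hz, max_eq_right h0]
    · rwa [hz, max_eq_left h0]
  have hez : Real.exp (-z) ≤ 1 := Real.exp_le_one_iff.2 (neg_nonpos.2 (le_max_right _ _))
  have hKM : K ≤ M := le_max_right _ _
  have hlK : l ≤ K := min_le_right _ _
  have hM' : M ≤ K * Real.exp (-z) + M * Real.exp (E.aPlus * (K - l)) * (1 - Real.exp (-z)) := by
    by_contra! hlt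
    obtain ⟨A, hAM, hA⟩ :=
      hx.exists_lt_eventually_le h hK hD hlim hl0 hlK hKM hMε hlε hzε hlt
    have h4 : limsup x atTop ≤ A := limsup_le_of_le hge.isCoboundedUnder_le hA
    -- The improved bound puts the upper limit below `M`, so `M` is the truncation value `K`; but
    -- then the right side of `hlt` is at least `K`.
    have h5 : M = K := by
      rcases max_choice (limsup x atTop) K with h6 | h6
      · rw [← hM] at h6
        linarith
      · exact h6
    rw [h5] at hlt
    have h7 : 1 ≤ Real.exp (E.aPlus * (K - l)) :=
      Real.one_le_exp (mul_nonneg haPlus.le (sub_nonneg.2 hlK))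
    have h8 := mul_le_mul_of_nonneg_left h7 (mul_nonneg hK.1.le (sub_nonneg.2 hez))
    linarith
  have hl' : K * Real.exp (-z) + l * Real.exp (-(E.aPlus * (M - K))) * (1 - Real.exp (-z)) ≤ l := by
    by_contra! hlt
    obtain ⟨A, hAl, hA⟩ :=
      hx.exists_gt_eventually_ge h hK hD hlim hl0 hlK hKM hMε hlε hzε hlt
    have h4 : A ≤ liminf x atTop := le_liminf_of_le hle.isCoboundedUnder_ge hA
    have h5 : l = K := by
      rcases min_choice (liminf x atTop) K with h6 | h6
      · rw [← hl] at h6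
        linarith
      · exact h6
    rw [h5] at hlt
    have h7 : Real.exp (-(E.aPlus * (M - K))) ≤ 1 :=
      Real.exp_le_one_iff.2 (neg_nonpos.2 (mul_nonneg haPlus.le (sub_nonneg.2 hKM)))
    have h8 := mul_le_mul_of_nonneg_left h7 (mul_nonneg hK.1.le (sub_nonneg.2 hez))
    linarith
  obtain ⟨hMK, hlK'⟩ := eq_of_limit_inequalities haPlus hK.1 (le_max_right _ _) hzK hKM hl0 hlK
    hM' hl'
  exact tendsto_of_le_liminf_of_limsup_le (hlK' ▸ min_le_left _ _) (hMK ▸ le_max_left _ _) hle hge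

theorem IsPositiveEquilibrium.isSolution {K : ℝ} (hK : E.IsPositiveEquilibrium K) :
    E.IsSolution fun _ => K := by
  refine ⟨continuousOn_const, fun t ht => ?_⟩
  refine (hasDerivWithinAt_const t (Ici 0) K).congr_deriv ?_
  rw [hK.2 t ht, Finset.sum_mul, eq_comm, sub_eq_zero]
  exact Finset.sum_congr rfl fun j _ => by ring

end NicholsonEq

theorem mainTheorem3 {m : ℕ} (E : NicholsonEq m)
    (hA0 : E.A0) (hA1 : E.A1) (hA2 : E.A2) (hA3 : E.A3)
    (K : ℝ) (hK1 : E.IsPositiveEquilibrium K)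
    (hK2 : E.aPlus * K * (Real.exp E.zetaPlus - 1) ≤ 1) :
    E.IsGlobalAttractor (fun _ => K) := by
  have := hK1.nonempty hA0
  refine ⟨hK1.isSolution, fun _ _ => hK1.1.le, fun φ hφ x hx => ?_⟩
  have hτ := hA0.maxDelay_nonneg
  have hpos : ∀ t ≥ 0, 0 < x t := fun t ht => hx.1.pos hA0
    (fun s hs => by rw [hx.2 ⟨hs.1, hs.2.le⟩]; exact hφ.2.1 s hs)
    (by rw [hx.2 ⟨neg_nonpos.2 hτ, le_rfl⟩]; exact hφ.2.2) ht
  exact tendsto_sub_nhds_zero_iff.2 (hx.1.tendsto_equilibrium hA0 hA2 hA3 hK1 hK2 hpos)
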